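/- Let $d\ge 1$ and $n\ge 3$ be integers and let $u\in\mathbb C$, $u\neq 0$. For $k\ge 1$ let ${\rm Y}_{d,k}(u)$ be the Yokonuma–Hecke algebra: the associative unital $\mathbb C$-algebra with generators $g_1,\dots,g_{k-1},t_1,\dots,t_k$ and relations $g_ig_j=g_jg_i$ for $|i-j|>1$; $g_{i+1}g_ig_{i+1}=g_ig_{i+1}g_i$; $t_it_j=t_jt_i$; $t_i^d=1$; $g_it_i=t_{i+1}g_i$; $g_it_{i+1}=t_ig_i$; $g_it_j=t_jg_i$ for $j\ne i,i+1$; and $g_i^2=1+(u-1)e_i+(u-1)e_ig_i$, where $e_i=\frac1d\sum_{s=0}^{d-1}t_i^st_{i+1}^{d-s}$. For $1\le i\le n-2$ put $$r_{i,i+1}=\sum_{\substack{a,b,c\in\mathbb Z/d\mathbb Z\\ a+b+c=0}}t_i^at_{i+1}^bt_{i+2}^c\,\bigl(1+g_i+g_{i+1}+g_ig_{i+1}+g_{i+1}g_i+g_ig_{i+1}g_i\bigr)\in{\rm Y}_{d,n}(u),$$ i.e. the sum of the elements $g_x$ over $x$ in the subgroup $\langle t_it_{i+1}^{-1},t_{i+1}t_{i+2}^{-1}\rangle\rtimes\langle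 s_i,s_{i+1}\rangle$ of $(\mathbb Z/d\mathbb Z)^n\rtimes S_n$, and let ${\rm FTL}_{d,n}(u)$ be the quotient of ${\rm Y}_{d,n}(u)$ by the two-sided ideal generated by all the $r_{i,i+1}$. Let $z,x_1,\dots,x_{d-1}\in\mathbb C$, put $x_0=1$, and let $x:\mathbb Z/d\mathbb Z\to\mathbb C$ be the function $k\mapsto x_k$. Let ${\rm tr}$ be Juyumaya's Markov trace with parameters $z,x_1,\dots,x_{d-1}$, i.e. the linear functional ${\rm tr}:\bigcup_{k\ge1}{\rm Y}_{d,k}(u)\to\mathbb C$ such that for all $k\ge 1$ and $a,b\in{\rm Y}_{d,k}(u)$ $${\rm tr}(ab)={\rm tr}(ba),\quad {\rm tr}(1)=1,\quad {\rm tr}(ag_k)=z\,{\rm tr}(a),\quad {\rm tr}(at_{k+1}^s)=x_s\,{\rm tr}(a)\ (1\le s\le d-1).$$ Write $\chi(j)=e^{2\pi i j/d}$ for $j\in\mathbb Z/d\mathbb Z$ and $\widehat x(m)=\sum_{k\in\mathbb Z/d\mathbb Z}x_k\,\chi(-km)$. Then ${\rm tr}$ passes to the quotient, i.e. its restriction to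 ${\rm Y}_{d,n}(u)$ factors through a linear functional on ${\rm FTL}_{d,n}(u)$, if and only if there are disjoint sets ${\rm Sup}_1,{\rm Sup}_2\subseteq\mathbb Z/d\mathbb Z$ whose union is the support of $\widehat x$ such that $$x_k=-z\Bigl(\sum_{m\in{\rm Sup}_1}\chi(km)+(u+1)\sum_{m\in{\rm Sup}_2}\chi(km)\Bigr)\quad\text{for all }k\in\mathbb Z/d\mathbb Z,$$ and $|{\rm Sup}_1|+(u+1)|{\rm Sup}_2|\neq0$ with $$z=-\frac1{|{\rm Sup}_1|+(u+1)|{\rm Sup}_2|}.$$ -/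

import Mathlib

/-- Generators of the Yokonuma–Hecke algebra on `n` strands.  Strands and braiding generators are
numbered from `0`: `t j` is the framing generator of strand `j` and `g i` braids the strands `i` and
`i + 1`. -/
inductive YHGen (n : ℕ) : Type
  | g (i : ℕ) (hi : i + 1 < n) : YHGen n
  | t (j : ℕ) (hj : j < n) : YHGen n

namespace YHFree

/-- The letter `g_i` in the free algebra. -/
noncomputable def g {n : ℕ} (i : ℕ) (hi : i + 1 < n) : FreeAlgebra ℂ (YHGen n) :=
  FreeAlgebra.ι ℂ (YHGen.g i hi)

/-- The letter `t_j` in the free algebra. -/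
noncomputable def t {n : ℕ} (j : ℕ) (hj : j < n) : FreeAlgebra ℂ (YHGen n) :=
  FreeAlgebra.ι ℂ (YHGen.t j hj)

/-- `e_i = (1/d) ∑_{s=0}^{d-1} t_i^s t_{i+1}^{d-s}`. -/
noncomputable def e (d : ℕ) {n : ℕ} (i : ℕ) (hi : i + 1 < n) : FreeAlgebra ℂ (YHGen n) :=
  (1 / (d : ℂ)) • ∑ s ∈ Finset.range d, t i (by omega) ^ s * t (i + 1) hi ^ (d - s)

end YHFree

/-- The defining relations of the Yokonuma–Hecke algebra. -/
inductive YHRel (d n : ℕ) (u : ℂ) : FreeAlgebra ℂ (YHGen n) → FreeAlgebra ℂ (YHGen n) → Prop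
  | g_comm (i j : ℕ) (hi : i + 1 < n) (hj : j + 1 < n) (hij : i + 1 < j ∨ j + 1 < i) :
      YHRel d n u (YHFree.g i hi * YHFree.g j hj) (YHFree.g j hj * YHFree.g i hi)
  | braid (i : ℕ) (hi : i + 1 < n) (hi' : i + 1 + 1 < n) :
      YHRel d n u (YHFree.g (i + 1) hi' * YHFree.g i hi * YHFree.g (i + 1) hi')
        (YHFree.g i hi * YHFree.g (i + 1) hi' * YHFree.g i hi)
  | t_comm (i j : ℕ) (hi : i < n) (hj : j < n) :
      YHRel d n u (YHFree.t i hi * YHFree.t j hj) (YHFree.t j hj * YHFree.t i hi)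
  | t_pow (i : ℕ) (hi : i < n) : YHRel d n u (YHFree.t i hi ^ d) 1
  | g_t_left (i : ℕ) (hi : i + 1 < n) (hi' : i < n) :
      YHRel d n u (YHFree.g i hi * YHFree.t i hi') (YHFree.t (i + 1) hi * YHFree.g i hi)
  | g_t_right (i : ℕ) (hi : i + 1 < n) (hi' : i < n) :
      YHRel d n u (YHFree.g i hi * YHFree.t (i + 1) hi) (YHFree.t i hi' * YHFree.g i hi)
  | g_t_other (i j : ℕ) (hi : i + 1 < n) (hj : j < n) (h : j ≠ i) (h' : j ≠ i + 1) :
      YHRel d n u (YHFree.g i hi * YHFree.t j hj) (YHFree.t j hj * YHFree.g i hi)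
  | quadratic (i : ℕ) (hi : i + 1 < n) :
      YHRel d n u (YHFree.g i hi ^ 2)
        (1 + (u - 1) • YHFree.e d i hi + (u - 1) • (YHFree.e d i hi * YHFree.g i hi))

/-- The Yokonuma–Hecke algebra `Y_{d,n}(u)`, by generators and relations over `ℂ`. -/
abbrev YokonumaHecke (d n : ℕ) (u : ℂ) : Type := RingQuot (YHRel d n u)

namespace YokonumaHecke

variable {d n : ℕ} {u : ℂ}

/-- The generator `g_i` of `Y_{d,n}(u)`. -/
noncomputable def g (i : ℕ) (hi : i + 1 < n) : YokonumaHecke d n u :=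
  RingQuot.mkAlgHom ℂ (YHRel d n u) (YHFree.g i hi)

/-- The generator `t_j` of `Y_{d,n}(u)`. -/
noncomputable def t (j : ℕ) (hj : j < n) : YokonumaHecke d n u :=
  RingQuot.mkAlgHom ℂ (YHRel d n u) (YHFree.t j hj)

/-- Where the generators of `Y_{d,n}(u)` go in `Y_{d,n+1}(u)`. -/
noncomputable def inclGen : YHGen n → YokonumaHecke d (n + 1) u
  | YHGen.g i hi => g i (by omega)
  | YHGen.t j hj => t j (by omega)

theorem lift_inclGen_g (i : ℕ) (hi : i + 1 < n) :
    FreeAlgebra.lift ℂ (inclGen (d := d) (u := u)) (YHFree.g i hi) =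
      RingQuot.mkAlgHom ℂ (YHRel d (n + 1) u) (YHFree.g i (by omega)) := by
  simp [YHFree.g, inclGen, g]

theorem lift_inclGen_t (j : ℕ) (hj : j < n) :
    FreeAlgebra.lift ℂ (inclGen (d := d) (u := u)) (YHFree.t j hj) =
      RingQuot.mkAlgHom ℂ (YHRel d (n + 1) u) (YHFree.t j (by omega)) := by
  simp [YHFree.t, inclGen, t]

theorem lift_inclGen_e (i : ℕ) (hi : i + 1 < n) :
    FreeAlgebra.lift ℂ (inclGen (d := d) (u := u)) (YHFree.e d i hi) =
      RingQuot.mkAlgHom ℂ (YHRel d (n + 1) u) (YHFree.e d i (by omega)) := by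
  simp only [YHFree.e, map_smul, map_sum, map_mul, map_pow, lift_inclGen_t]

theorem lift_inclGen_rel ⦃a b : FreeAlgebra ℂ (YHGen n)⦄ (h : YHRel d n u a b) :
    FreeAlgebra.lift ℂ (inclGen (d := d) (u := u)) a =
      FreeAlgebra.lift ℂ (inclGen (d := d) (u := u)) b := by
  cases h <;>
    simp only [map_mul, map_pow, map_add, map_smul, map_one, lift_inclGen_g, lift_inclGen_t,
      lift_inclGen_e] <;>
    simp only [← map_mul, ← map_pow, ← map_add, ← map_smul,
      ← map_one (RingQuot.mkAlgHom ℂ (YHRel d (n + 1) u))] <;>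
    apply RingQuot.mkAlgHom_rel
  · exact YHRel.g_comm _ _ _ _ ‹_›
  · exact YHRel.braid _ _ _
  · exact YHRel.t_comm _ _ _ _
  · exact YHRel.t_pow _ _
  · exact YHRel.g_t_left _ _ _
  · exact YHRel.g_t_right _ _ _
  · exact YHRel.g_t_other _ _ _ _ ‹_› ‹_›
  · exact YHRel.quadratic _ _

/-- The canonical homomorphism `Y_{d,n}(u) → Y_{d,n+1}(u)` that adds one strand on the right:
`g_i ↦ g_i` and `t_j ↦ t_j`. -/
noncomputable def incl : YokonumaHecke d n u →ₐ[ℂ] YokonumaHecke d (n + 1) u :=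
  RingQuot.liftAlgHom ℂ ⟨FreeAlgebra.lift ℂ inclGen, lift_inclGen_rel⟩

/-- `∑ g_w` over the six elements `w` of the subgroup `⟨s_i, s_{i+1}⟩` of the symmetric group, each
written as a reduced word in `s_i`, `s_{i+1}`. -/
noncomputable def steinberg (i : ℕ) (hi : i + 2 < n) : YokonumaHecke d n u :=
  1 + g i (by omega) + g (i + 1) hi + g i (by omega) * g (i + 1) hi + g (i + 1) hi * g i (by omega)
    + g i (by omega) * g (i + 1) hi * g i (by omega)

/-- The element `r_{i,i+1} = ∑ g_x`, where `x` runs over the subgroup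
`⟨t_i t_{i+1}⁻¹, t_{i+1} t_{i+2}⁻¹⟩ ⋊ ⟨s_i, s_{i+1}⟩` of `(ℤ/d)ⁿ ⋊ S_n`: such an `x` is uniquely
`t_i^a t_{i+1}^b t_{i+2}^c w` with `a + b + c = 0` in `ℤ/d` and `w ∈ ⟨s_i, s_{i+1}⟩`, and then
`g_x = t_i^a t_{i+1}^b t_{i+2}^c g_w`. -/
noncomputable def r [NeZero d] (i : ℕ) (hi : i + 2 < n) : YokonumaHecke d n u :=
  ∑ a : ZMod d, ∑ b : ZMod d, ∑ c : ZMod d,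
    if a + b + c = 0 then
      t i (by omega) ^ a.val * t (i + 1) (by omega) ^ b.val * t (i + 2) hi ^ c.val * steinberg i hi
    else 0

end YokonumaHecke

/-- The two-sided ideal of `Y_{d,n}(u)` generated by all the elements `r_{i,i+1}`. -/
noncomputable def ftlIdeal (d n : ℕ) [NeZero d] (u : ℂ) : TwoSidedIdeal (YokonumaHecke d n u) :=
  TwoSidedIdeal.span {y | ∃ (i : ℕ) (hi : i + 2 < n), y = YokonumaHecke.r i hi}

/-- The framization of the Temperley–Lieb algebra, `FTL_{d,n}(u) = Y_{d,n}(u) / ⟨r_{i,i+1}⟩`. -/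
abbrev FTL (d n : ℕ) [NeZero d] (u : ℂ) : Type := (ftlIdeal d n u).ringCon.Quotient

/-- A linear functional on `Y_{d,n}(u)` passes to the quotient `FTL_{d,n}(u)` if it factors through
the canonical projection. -/
def PassesToFTL {d n : ℕ} [NeZero d] {u : ℂ} (τ : YokonumaHecke d n u →ₗ[ℂ] ℂ) : Prop :=
  ∃ σ : FTL d n u →ₗ[ℂ] ℂ, ∀ a : YokonumaHecke d n u, σ ((ftlIdeal d n u).ringCon.mk' a) = τ a

/-- `tr` is Juyumaya's Markov trace on `⋃_{n ≥ 1} Y_{d,n}(u)` with parameters `z` and `x_s`, `s ≠ 0`: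
a linear functional on the union, given as a family of functionals on the `Y_{d,n}(u)` that is
compatible with the maps `Y_{d,n}(u) → Y_{d,n+1}(u)`, subject to the four inductive rules.  (With
strands numbered from `0`, the last generators of `Y_{d,n+1}(u)` are `t n` and `g (n - 1)`; below
`n = m + 1`.) -/
structure IsJuyumayaTrace (d : ℕ) (u z : ℂ) (x : ZMod d → ℂ)
    (tr : ∀ n : ℕ, YokonumaHecke d n u →ₗ[ℂ] ℂ) : Prop where
  compat : ∀ (m : ℕ) (a : YokonumaHecke d (m + 1) u),
    tr (m + 2) (YokonumaHecke.incl a) = tr (m + 1) a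
  trace : ∀ (m : ℕ) (a b : YokonumaHecke d (m + 1) u), tr (m + 1) (a * b) = tr (m + 1) (b * a)
  unit : ∀ m : ℕ, tr (m + 1) 1 = 1
  markov : ∀ (m : ℕ) (a : YokonumaHecke d (m + 1) u),
    tr (m + 2) (YokonumaHecke.incl a * YokonumaHecke.g m (by omega)) = z * tr (m + 1) a
  framing : ∀ (m : ℕ) (a : YokonumaHecke d (m + 1) u) (s : ZMod d), s ≠ 0 →
    tr (m + 2) (YokonumaHecke.incl a * YokonumaHecke.t (m + 1) (by omega) ^ s.val) =
      x s * tr (m + 1) a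

/-! The primitive idempotents of the framing group cut everything into Hecke-type corners. Let `E_m`
project three consecutive strands onto the eigenvalue `χ(m)` and let `S` be the six-term sum
`steinberg`. Fourier analysis on the subgroup `a + b + c = 0` gives `r = d² ∑ E_m S` (`r_eq_sum`).
Below `E_m` each `g` satisfies the ordinary Hecke relation, so `g E_m S = u E_m S`
(`g_mul_tripleProj_mul_steinberg`): on three strands the left ideal of `r` is spanned by the `E_m
S`.

With `X = x̂(m)/d`, the Markov rules evaluate `tr(E_m S) = X (X + z)(X + (u + 1) z)`
(`tr_tripleProj_mul_steinberg`). Thus on three strands the trace kills the ideal exactly when every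
`x̂(m)/d` lies in `{0, -z, -(u + 1)z}`.

The general case reduces to this one. A trace factors through the quotient iff it kills all `y
r_{i,i+1}` (`passesToFTL_iff`); the `r_{i,i+1}` are conjugate, so `i = 0` suffices
(`tr_mul_r_eq_zero`); and since `Y_{d,n+1}` is spanned by `a t_n^s` and `a g_{n-1} b`
(`inductiveSpan_eq_top`), the Markov rules remove strands beyond the third (`killsFirst_iff`).
Fourier inversion turns the root condition into the formula for `x`, and `x 0 = 1` fixes `z`
(`fourier_roots_iff_exists_supports`). -/

namespace YokonumaHecke

variable {d n : ℕ} {u : ℂ}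

/-! ### Relations and generation -/

/-- The idempotent `e_i` of `Y_{d,n}(u)`. -/
noncomputable def e (i : ℕ) (hi : i + 1 < n) : YokonumaHecke d n u :=
  RingQuot.mkAlgHom ℂ (YHRel d n u) (YHFree.e d i hi)

theorem e_eq_sum (i : ℕ) (hi : i + 1 < n) :
    (e i hi : YokonumaHecke d n u) =
      (1 / (d : ℂ)) • ∑ s ∈ Finset.range d, t i (by omega) ^ s * t (i + 1) hi ^ (d - s) := by
  simp only [e, YHFree.e, map_smul, map_sum, map_mul, map_pow, t]

theorem g_mul_g_comm (i j : ℕ) (hi : i + 1 < n) (hj : j + 1 < n) (hij : i + 1 < j ∨ j + 1 < i) :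
    (g i hi * g j hj : YokonumaHecke d n u) = g j hj * g i hi := by
  have h := RingQuot.mkAlgHom_rel ℂ (YHRel.g_comm (d := d) (u := u) i j hi hj hij)
  simp only [map_mul] at h
  exact h

theorem g_braid (i : ℕ) (hi : i + 1 < n) (hi' : i + 1 + 1 < n) :
    (g (i + 1) hi' * g i hi * g (i + 1) hi' : YokonumaHecke d n u) =
      g i hi * g (i + 1) hi' * g i hi := by
  have h := RingQuot.mkAlgHom_rel ℂ (YHRel.braid (d := d) (u := u) i hi hi')
  simp only [map_mul] at h
  exact h

theorem t_mul_t_comm (i j : ℕ) (hi : i < n) (hj : j < n) :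
    Commute (t i hi : YokonumaHecke d n u) (t j hj) := by
  have h := RingQuot.mkAlgHom_rel ℂ (YHRel.t_comm (d := d) (u := u) i j hi hj)
  simp only [map_mul] at h
  exact h

theorem t_pow_d (i : ℕ) (hi : i < n) : (t i hi : YokonumaHecke d n u) ^ d = 1 := by
  have h := RingQuot.mkAlgHom_rel ℂ (YHRel.t_pow (d := d) (u := u) i hi)
  simp only [map_pow, map_one] at h
  exact h

theorem g_mul_t_left (i : ℕ) (hi : i + 1 < n) :
    SemiconjBy (g i hi : YokonumaHecke d n u) (t i (by omega)) (t (i + 1) hi) := by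
  have h := RingQuot.mkAlgHom_rel ℂ (YHRel.g_t_left (d := d) (u := u) i hi (by omega))
  simp only [map_mul] at h
  exact h

theorem g_mul_t_right (i : ℕ) (hi : i + 1 < n) :
    SemiconjBy (g i hi : YokonumaHecke d n u) (t (i + 1) hi) (t i (by omega)) := by
  have h := RingQuot.mkAlgHom_rel ℂ (YHRel.g_t_right (d := d) (u := u) i hi (by omega))
  simp only [map_mul] at h
  exact h

theorem g_mul_t_other (i j : ℕ) (hi : i + 1 < n) (hj : j < n) (h₁ : j ≠ i) (h₂ : j ≠ i + 1) :
    Commute (g i hi : YokonumaHecke d n u) (t j hj) := by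
  have h := RingQuot.mkAlgHom_rel ℂ (YHRel.g_t_other (d := d) (u := u) i j hi hj h₁ h₂)
  simp only [map_mul] at h
  exact h

theorem g_sq (i : ℕ) (hi : i + 1 < n) :
    (g i hi * g i hi : YokonumaHecke d n u) =
      1 + (u - 1) • e i hi + (u - 1) • (e i hi * g i hi) := by
  have h := RingQuot.mkAlgHom_rel ℂ (YHRel.quadratic (d := d) (u := u) i hi)
  simp only [map_add, map_smul, map_mul, map_one, pow_two] at h
  exact h

theorem incl_mk (a : FreeAlgebra ℂ (YHGen n)) :
    incl (RingQuot.mkAlgHom ℂ (YHRel d n u) a) = FreeAlgebra.lift ℂ inclGen a := by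
  simp [incl]

@[simp]
theorem incl_g (i : ℕ) (hi : i + 1 < n) :
    incl (g i hi : YokonumaHecke d n u) = g i (by omega) := by
  rw [g, incl_mk, lift_inclGen_g]; rfl

@[simp]
theorem incl_t (j : ℕ) (hj : j < n) :
    incl (t j hj : YokonumaHecke d n u) = t j (by omega) := by
  rw [t, incl_mk, lift_inclGen_t]; rfl

/-- A property that holds for the generators and is stable under the algebra operations holds
everywhere. -/
theorem mem_of_generators (A : Subalgebra ℂ (YokonumaHecke d n u))
    (hg : ∀ i hi, g i hi ∈ A) (ht : ∀ j hj, t j hj ∈ A) (y : YokonumaHecke d n u) : y ∈ A := by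
  obtain ⟨y, rfl⟩ := RingQuot.mkAlgHom_surjective ℂ (YHRel d n u) y
  induction y using FreeAlgebra.induction with
  | grade0 c => rw [AlgHom.commutes]; exact A.algebraMap_mem c
  | grade1 v =>
    cases v with
    | g i hi => exact hg i hi
    | t j hj => exact ht j hj
  | mul a b ha hb => rw [map_mul]; exact A.mul_mem ha hb
  | add a b ha hb => rw [map_add]; exact A.add_mem ha hb

/-- A subspace stable under left multiplication by the generators is a left ideal. -/
theorem mul_mem_of_generators (V : Submodule ℂ (YokonumaHecke d n u))
    (hg : ∀ i hi, ∀ v ∈ V, g i hi * v ∈ V) (ht : ∀ j hj, ∀ v ∈ V, t j hj * v ∈ V)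
    (y : YokonumaHecke d n u) {v : YokonumaHecke d n u} (hv : v ∈ V) : y * v ∈ V := by
  let A : Subalgebra ℂ (YokonumaHecke d n u) :=
    { carrier := {y | ∀ v ∈ V, y * v ∈ V}
      mul_mem' := fun {a b} ha hb v hv => by rw [mul_assoc]; exact ha _ (hb _ hv)
      add_mem' := fun {a b} ha hb v hv => by rw [add_mul]; exact V.add_mem (ha _ hv) (hb _ hv)
      algebraMap_mem' := fun c v hv => by
        rw [← Algebra.smul_def]; exact V.smul_mem c hv }
  exact mem_of_generators A hg ht y v hv

theorem commute_incl (b : YokonumaHecke d (n + 1) u)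
    (hg : ∀ i (hi : i + 1 < n), Commute b (g i (by omega)))
    (ht : ∀ j (hj : j < n), Commute b (t j (by omega))) (a : YokonumaHecke d n u) :
    Commute b (incl a) := by
  have := mem_of_generators ((Subalgebra.centralizer ℂ {b}).comap incl) (fun i hi => ?_)
    (fun j hj => ?_) a
  · simpa [Subalgebra.mem_centralizer_iff, commute_iff_eq] using this
  · simpa [Subalgebra.mem_centralizer_iff] using (hg i hi).eq
  · simpa [Subalgebra.mem_centralizer_iff] using (ht j hj).eq

theorem t_last_commute_incl (a : YokonumaHecke d n u) :
    Commute (t n (by omega) : YokonumaHecke d (n + 1) u) (incl a) :=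
  commute_incl _ (fun i hi => (g_mul_t_other i n _ _ (by omega) (by omega)).symm)
    (fun j hj => t_mul_t_comm n j _ _) a

theorem g_last_commute_incl (a : YokonumaHecke d n u) :
    Commute (g n (by omega) : YokonumaHecke d (n + 2) u) (incl (incl a)) := by
  have := mem_of_generators (n := n)
    ((Subalgebra.centralizer ℂ {(g n (by omega) : YokonumaHecke d (n + 2) u)}).comap
      (incl.comp incl)) (fun i hi => ?_) (fun j hj => ?_) a
  · simpa [Subalgebra.mem_centralizer_iff, commute_iff_eq] using this
  · simpa [Subalgebra.mem_centralizer_iff] using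
      g_mul_g_comm (d := d) (u := u) n i (by omega) (by omega : i + 1 < n + 2) (by omega)
  · simpa [Subalgebra.mem_centralizer_iff] using
      (g_mul_t_other (d := d) (u := u) n j (by omega) (by omega) (by omega) (by omega)).eq

/-! ### The inductive spanning set -/

/-- The span of the elements `a t_n^s` and `a g_{n-1} b` with `a`, `b` from `Y_{d,n}(u)`. -/
noncomputable def inductiveSpan (d n : ℕ) (u : ℂ) : Submodule ℂ (YokonumaHecke d (n + 1) u) :=
  Submodule.span ℂ
    ({y | ∃ (a : YokonumaHecke d n u) (s : ℕ), y = incl a * t n (by omega) ^ s} ∪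
      {y | ∃ (a b : YokonumaHecke d n u) (i : ℕ) (hi : i + 1 < n + 1), i + 1 = n ∧
        y = incl a * g i hi * incl b})

theorem incl_mul_t_pow_mem (a : YokonumaHecke d n u) (s : ℕ) :
    incl a * t n (by omega) ^ s ∈ inductiveSpan d n u :=
  Submodule.subset_span (Or.inl ⟨a, s, rfl⟩)

theorem incl_mul_g_mul_incl_mem (a b : YokonumaHecke d (n + 1) u) :
    incl a * g n (by omega) * incl b ∈ inductiveSpan d (n + 1) u :=
  Submodule.subset_span (Or.inr ⟨a, b, n, by omega, rfl, rfl⟩)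

theorem inductiveSpan_le {V : Submodule ℂ (YokonumaHecke d (n + 1) u)}
    (h₁ : ∀ (a : YokonumaHecke d n u) (s : ℕ), incl a * t n (by omega) ^ s ∈ V)
    (h₂ : ∀ (a b : YokonumaHecke d n u) (i : ℕ) (hi : i + 1 < n + 1), i + 1 = n →
      incl a * g i hi * incl b ∈ V) : inductiveSpan d n u ≤ V := by
  rw [inductiveSpan, Submodule.span_le]
  rintro y (⟨a, s, rfl⟩ | ⟨a, b, i, hi, h, rfl⟩)
  exacts [h₁ a s, h₂ a b i hi h]

theorem mul_incl_mem (b : YokonumaHecke d n u) {y : YokonumaHecke d (n + 1) u}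
    (hy : y ∈ inductiveSpan d n u) : y * incl b ∈ inductiveSpan d n u := by
  refine inductiveSpan_le (V := (inductiveSpan d n u).comap (LinearMap.mulRight ℂ (incl b)))
    (fun a s => ?_) (fun a c i hi h => ?_) hy
  · rw [Submodule.mem_comap, LinearMap.mulRight_apply, mul_assoc,
      ((t_last_commute_incl b).pow_left s).eq, ← mul_assoc, ← map_mul]
    exact incl_mul_t_pow_mem _ _
  · subst h
    rw [Submodule.mem_comap, LinearMap.mulRight_apply, mul_assoc, ← map_mul]
    exact incl_mul_g_mul_incl_mem _ _

theorem incl_mul_mem (b : YokonumaHecke d n u) {y : YokonumaHecke d (n + 1) u}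
    (hy : y ∈ inductiveSpan d n u) : incl b * y ∈ inductiveSpan d n u := by
  refine inductiveSpan_le (V := (inductiveSpan d n u).comap (LinearMap.mulLeft ℂ (incl b)))
    (fun a s => ?_) (fun a c i hi h => ?_) hy
  · rw [Submodule.mem_comap, LinearMap.mulLeft_apply, ← mul_assoc, ← map_mul]
    exact incl_mul_t_pow_mem _ _
  · subst h
    rw [Submodule.mem_comap, LinearMap.mulLeft_apply, ← mul_assoc, ← mul_assoc, ← map_mul]
    exact incl_mul_g_mul_incl_mem _ _

/-- The last `t` commutes with `a` and crosses `g` to become the previous framing generator, which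
is absorbed into the right factor. -/
theorem t_mul_mem {y : YokonumaHecke d (n + 1) u} (hy : y ∈ inductiveSpan d n u) :
    t n (by omega) * y ∈ inductiveSpan d n u := by
  refine inductiveSpan_le (V := (inductiveSpan d n u).comap (LinearMap.mulLeft ℂ (t n (by omega))))
    (fun a s => ?_) (fun a c i hi h => ?_) hy
  · rw [Submodule.mem_comap, LinearMap.mulLeft_apply, ← mul_assoc, (t_last_commute_incl a).eq,
      mul_assoc, ← pow_succ']
    exact incl_mul_t_pow_mem _ _
  · subst h
    rw [Submodule.mem_comap, LinearMap.mulLeft_apply, ← mul_assoc, ← mul_assoc,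
      (t_last_commute_incl a).eq, mul_assoc (incl a), ← (g_mul_t_left i hi).eq, ← mul_assoc,
      mul_assoc _ _ (incl c), ← incl_t i (by omega), ← map_mul]
    exact incl_mul_g_mul_incl_mem _ _

theorem t_pow_mul_mem (s : ℕ) {y : YokonumaHecke d (n + 1) u} (hy : y ∈ inductiveSpan d n u) :
    t n (by omega) ^ s * y ∈ inductiveSpan d n u := by
  induction s with
  | zero => simpa using hy
  | succ s ih => rw [pow_succ', mul_assoc]; exact t_mul_mem ih

theorem one_mem_inductiveSpan : (1 : YokonumaHecke d (n + 1) u) ∈ inductiveSpan d n u := by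
  simpa using incl_mul_t_pow_mem (d := d) (n := n) (u := u) 1 0

theorem g_mem_inductiveSpan :
    (g n (by omega) : YokonumaHecke d (n + 2) u) ∈ inductiveSpan d (n + 1) u := by
  simpa using incl_mul_g_mul_incl_mem (d := d) (n := n) (u := u) 1 1

theorem e_mul_mem {y : YokonumaHecke d (n + 2) u} (hy : y ∈ inductiveSpan d (n + 1) u) :
    e n (by omega) * y ∈ inductiveSpan d (n + 1) u := by
  rw [e_eq_sum, smul_mul_assoc, Finset.sum_mul]
  refine Submodule.smul_mem _ _ (Submodule.sum_mem _ fun s _ => ?_)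
  rw [mul_assoc, ← incl_t n (by omega), ← map_pow]
  exact incl_mul_mem _ (t_pow_mul_mem _ hy)

theorem g_mul_g_mem :
    (g n (by omega) * g n (by omega) : YokonumaHecke d (n + 2) u) ∈ inductiveSpan d (n + 1) u := by
  rw [g_sq]
  refine add_mem (add_mem one_mem_inductiveSpan (Submodule.smul_mem _ _ ?_))
    (Submodule.smul_mem _ _ (e_mul_mem g_mem_inductiveSpan))
  simpa using e_mul_mem (one_mem_inductiveSpan (d := d) (n := n + 1) (u := u))

/-- The difficulty is `g_n a g_n`, with two occurrences of `g_n`. Expanding `a` by `h` leaves two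
cases: `g_n a' t_n^s g_n = a' t_{n+1}^s g_n²`, reduced by the quadratic relation, and `g_n a'
g_{n-1} c g_n = a' (g_n g_{n-1} g_n) c`, reduced by the braid relation. -/
theorem g_mul_mem (h : inductiveSpan d n u = ⊤) {y : YokonumaHecke d (n + 2) u}
    (hy : y ∈ inductiveSpan d (n + 1) u) :
    g n (by omega) * y ∈ inductiveSpan d (n + 1) u := by
  have key (a : YokonumaHecke d (n + 1) u) :
      g n (by omega) * incl a * g n (by omega) ∈ inductiveSpan d (n + 1) u := by
    have ha : a ∈ inductiveSpan d n u := h ▸ Submodule.mem_top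
    refine inductiveSpan_le (V := (inductiveSpan d (n + 1) u).comap
      ((LinearMap.mulRight ℂ (g n (by omega))) ∘ₗ (LinearMap.mulLeft ℂ (g n (by omega))) ∘ₗ
        incl.toLinearMap)) (fun a s => ?_) (fun a c i hi h => ?_) ha
    · change g n _ * incl (incl a * t n _ ^ s) * g n _ ∈ inductiveSpan d (n + 1) u
      rw [map_mul, map_pow, incl_t, ← mul_assoc, (g_last_commute_incl a).eq, mul_assoc (incl _),
        ((g_mul_t_left n (by omega)).pow_right s).eq, ← mul_assoc, mul_assoc, mul_assoc]
      exact incl_mul_mem _ (t_pow_mul_mem _ g_mul_g_mem)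
    · subst h
      change g (i + 1) _ * incl (incl a * g i hi * incl c) * g (i + 1) _ ∈
        inductiveSpan d (i + 2) u
      rw [map_mul, map_mul, incl_g, ← mul_assoc, ← mul_assoc, (g_last_commute_incl a).eq,
        mul_assoc _ (incl (incl c)), ← (g_last_commute_incl c).eq, mul_assoc (incl (incl a)),
        mul_assoc (incl (incl a)), ← mul_assoc _ _ (incl (incl c)), g_braid,
        ← incl_g i (by omega)]
      exact incl_mul_mem _ (mul_incl_mem _ (incl_mul_g_mul_incl_mem _ _))
  refine inductiveSpan_le (V := (inductiveSpan d (n + 1) u).comap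
    (LinearMap.mulLeft ℂ (g n (by omega)))) (fun a s => ?_) (fun a c i hi h => ?_) hy
  · rw [Submodule.mem_comap, LinearMap.mulLeft_apply, ← ((t_last_commute_incl a).pow_left s).eq,
      ← mul_assoc, ((g_mul_t_right n (by omega)).pow_right s).eq, ← incl_t n (by omega), ← map_pow]
    exact incl_mul_g_mul_incl_mem _ _
  · obtain rfl : i = n := by omega
    rw [Submodule.mem_comap, LinearMap.mulLeft_apply, ← mul_assoc, ← mul_assoc]
    exact mul_incl_mem _ (key a)

/-- The span contains `1` and is stable under left multiplication by every generator; stability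
under the new `g` needs the statement one level below, hence the induction. -/
theorem inductiveSpan_eq_top : inductiveSpan d n u = ⊤ := by
  induction n with
  | zero =>
    rw [eq_top_iff]
    rintro y -
    rw [← mul_one y]
    refine mul_mem_of_generators _ (fun i hi => ?_) (fun j hj v hv => ?_) y one_mem_inductiveSpan
    · omega
    · obtain rfl : j = 0 := by omega
      exact t_mul_mem hv
  | succ n ih =>
    rw [eq_top_iff]
    rintro y -
    rw [← mul_one y]
    refine mul_mem_of_generators _ (fun i hi v hv => ?_) (fun j hj v hv => ?_) y
      one_mem_inductiveSpan
    · obtain rfl | h := eq_or_ne i n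
      · exact g_mul_mem ih hv
      · rw [← incl_g i (by omega)]
        exact incl_mul_mem _ hv
    · obtain rfl | h := eq_or_ne j (n + 1)
      · exact t_mul_mem hv
      · rw [← incl_t j (by omega)]
        exact incl_mul_mem _ hv

end YokonumaHecke

theorem SemiconjBy.finset_sum_right {R ι : Type*} [NonUnitalNonAssocSemiring R] {w : R}
    (s : Finset ι) {f f' : ι → R} (h : ∀ i ∈ s, SemiconjBy w (f i) (f' i)) :
    SemiconjBy w (∑ i ∈ s, f i) (∑ i ∈ s, f' i) := by
  rw [SemiconjBy, Finset.mul_sum, Finset.sum_mul]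
  exact Finset.sum_congr rfl h

/-! ### Absorption of Hecke generators by the six-term sum -/

section SteinbergAbsorption

variable {R : Type*} [Ring R] [Algebra ℂ R] {u : ℂ} {E A B : R}

/-- The sum factors as `(1 + A)(1 + B + BA)`, and below `E` the Hecke relation gives `A(1 + A) = u(1
+ A)`. -/
theorem mul_steinberg_left (hEA : Commute E A)
    (hA : E * A * A = u • E + (u - 1) • (E * A)) :
    A * (E * (1 + A + B + A * B + B * A + A * B * A)) =
      u • (E * (1 + A + B + A * B + B * A + A * B * A)) := by
  have hA' (y : R) : E * (A * (A * y)) = u • (E * y) + (u - 1) • (E * (A * y)) := by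
    have := congrArg (· * y) hA
    simpa only [mul_assoc, add_mul, smul_mul_assoc] using this
  rw [← mul_assoc A, ← hEA.eq]
  simp only [mul_add, mul_assoc, mul_one, hA']
  rw [← mul_assoc E A A, hA]
  module

/-- After rewriting `ABA` as `BAB`, the sum factors as `(1 + B)(1 + A + AB)`. -/
theorem mul_steinberg_right (hEB : Commute E B)
    (hB : E * B * B = u • E + (u - 1) • (E * B)) (hbraid : B * A * B = A * B * A) :
    B * (E * (1 + A + B + A * B + B * A + A * B * A)) =
      u • (E * (1 + A + B + A * B + B * A + A * B * A)) := by
  have hB' (y : R) : E * (B * (B * y)) = u • (E * y) + (u - 1) • (E * (B * y)) := by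
    have := congrArg (· * y) hB
    simpa only [mul_assoc, add_mul, smul_mul_assoc] using this
  rw [← hbraid, ← mul_assoc B, ← hEB.eq]
  simp only [mul_add, mul_assoc, mul_one, hB']
  rw [← mul_assoc E B B, hB]
  module

end SteinbergAbsorption

namespace YokonumaHecke

open ZMod

variable {d n : ℕ} {u : ℂ}

theorem t_pow_mod (j : ℕ) (hj : j < n) (k : ℕ) :
    (t j hj : YokonumaHecke d n u) ^ (k % d) = t j hj ^ k := by
  conv_rhs => rw [← Nat.mod_add_div k d, pow_add, pow_mul, t_pow_d, one_pow, mul_one]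

theorem incl_steinberg (i : ℕ) (hi : i + 2 < n) :
    incl (steinberg i hi : YokonumaHecke d n u) = steinberg i (by omega) := by
  simp [steinberg]

theorem t_pow_val_natCast (j : ℕ) (hj : j < n) (k : ℕ) :
    (t j hj : YokonumaHecke d n u) ^ (k : ZMod d).val = t j hj ^ k := by
  rw [val_natCast, t_pow_mod]

variable [NeZero d]

theorem t_pow_val_add (j : ℕ) (hj : j < n) (a b : ZMod d) :
    (t j hj : YokonumaHecke d n u) ^ (a + b).val = t j hj ^ a.val * t j hj ^ b.val := by
  rw [val_add, t_pow_mod, pow_add]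

/-! ### The idempotents of a strand -/

/-- The idempotent of `Y_{d,n}(u)` onto the eigenspace of `t_j` for the eigenvalue `χ(m)`. -/
noncomputable def proj (j : ℕ) (hj : j < n) (m : ZMod d) : YokonumaHecke d n u :=
  (1 / (d : ℂ)) • ∑ s : ZMod d, stdAddChar (-(s * m)) • t j hj ^ s.val

theorem t_pow_mul_proj (j : ℕ) (hj : j < n) (a m : ZMod d) :
    (t j hj ^ a.val * proj j hj m : YokonumaHecke d n u) = stdAddChar (a * m) • proj j hj m := by
  rw [proj, mul_smul_comm, smul_comm (stdAddChar (a * m))]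
  congr 1
  rw [Finset.mul_sum, Finset.smul_sum]
  refine Fintype.sum_equiv (Equiv.addLeft a) _ _ fun s => ?_
  rw [Equiv.coe_addLeft, mul_smul_comm, ← t_pow_val_add, smul_smul, ← AddChar.map_add_eq_mul]
  congr 2
  ring

theorem proj_mul_proj (j : ℕ) (hj : j < n) (m : ZMod d) :
    (proj j hj m * proj j hj m : YokonumaHecke d n u) = proj j hj m := by
  conv_lhs => enter [1]; rw [proj]
  simp only [smul_mul_assoc, Finset.sum_mul, t_pow_mul_proj, smul_smul, ← AddChar.map_add_eq_mul,
    neg_add_cancel, AddChar.map_zero_eq_one, one_smul, Finset.sum_const, Finset.card_univ, card,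
    ← Nat.cast_smul_eq_nsmul ℂ]
  rw [one_div_mul_cancel (NeZero.ne (d : ℂ)), one_smul]

theorem sum_proj (j : ℕ) (hj : j < n) : (∑ m, proj j hj m : YokonumaHecke d n u) = 1 := by
  have h (s : ZMod d) : ∑ m : ZMod d, stdAddChar (-(s * m)) = if s = 0 then (d : ℂ) else 0 := by
    split_ifs with h
    · simp [h, card]
    · simp_rw [← neg_mul]
      exact AddChar.sum_eq_zero_of_ne_one (isPrimitive_stdAddChar d (neg_ne_zero.mpr h))
  simp only [proj, ← Finset.smul_sum]
  rw [Finset.sum_comm]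
  simp only [← Finset.sum_smul, h, ite_smul, zero_smul, Finset.sum_ite_eq', Finset.mem_univ,
    if_true, val_zero, pow_zero, smul_smul]
  rw [one_div_mul_cancel (NeZero.ne (d : ℂ)), one_smul]

theorem semiconjBy_proj {w : YokonumaHecke d n u} {i j : ℕ} {hi : i < n} {hj : j < n}
    (h : SemiconjBy w (t i hi) (t j hj)) (m : ZMod d) :
    SemiconjBy w (proj i hi m) (proj j hj m) :=
  (SemiconjBy.finset_sum_right _ fun _ _ => (h.pow_right _).smul_right _).smul_right _

theorem t_commute_proj (i j : ℕ) (hi : i < n) (hj : j < n) (m : ZMod d) :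
    Commute (t i hi : YokonumaHecke d n u) (proj j hj m) :=
  semiconjBy_proj (t_mul_t_comm i j hi hj) m

theorem proj_commute_proj (i j : ℕ) (hi : i < n) (hj : j < n) (m m' : ZMod d) :
    Commute (proj i hi m : YokonumaHecke d n u) (proj j hj m') :=
  semiconjBy_proj (t_commute_proj j i hj hi m).symm m'

theorem proj_mul_t_pow (j : ℕ) (hj : j < n) (a m : ZMod d) :
    (proj j hj m * t j hj ^ a.val : YokonumaHecke d n u) = stdAddChar (a * m) • proj j hj m := by
  rw [← t_pow_mul_proj, ((t_commute_proj j j hj hj m).pow_left _).eq]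

theorem t_mul_proj (j : ℕ) (hj : j < n) (m : ZMod d) :
    (t j hj * proj j hj m : YokonumaHecke d n u) = stdAddChar m • proj j hj m := by
  have := t_pow_mul_proj (u := u) j hj ((1 : ℕ) : ZMod d) m
  rwa [t_pow_val_natCast, pow_one, Nat.cast_one, one_mul] at this

@[simp]
theorem incl_proj (j : ℕ) (hj : j < n) (m : ZMod d) :
    incl (proj j hj m : YokonumaHecke d n u) = proj j (by omega) m := by
  simp [proj]

/-! ### The idempotent `e_i` and invertibility of `g_i` -/

theorem e_eq_sum_zmod (i : ℕ) (hi : i + 1 < n) :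
    (e i hi : YokonumaHecke d n u) =
      (1 / (d : ℂ)) • ∑ a : ZMod d, t i (by omega) ^ a.val * t (i + 1) hi ^ (-a).val := by
  rw [e_eq_sum]
  congr 1
  refine Finset.sum_nbij' (fun s => (s : ZMod d)) ZMod.val (fun _ _ => Finset.mem_univ _)
    (fun a _ => Finset.mem_range.mpr a.val_lt)
    (fun s hs => val_cast_of_lt (Finset.mem_range.mp hs)) (fun a _ => natCast_zmod_val a)
    (fun s hs => ?_)
  -- For `s = 0` the exponent `d - s` is `d`, while `(-0).val = 0`; the two powers agree because `t
  -- ^ d = 1`.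
  rw [t_pow_val_natCast, ← t_pow_val_natCast (i + 1) hi (d - s),
    Nat.cast_sub (Finset.mem_range.mp hs).le, natCast_self, zero_sub]

theorem t_pow_mul_t_pow_neg_mul_e (i : ℕ) (hi : i + 1 < n) (a : ZMod d) :
    (t i (by omega) ^ a.val * t (i + 1) hi ^ (-a).val * e i hi : YokonumaHecke d n u) =
      e i hi := by
  rw [e_eq_sum_zmod, mul_smul_comm, Finset.mul_sum]
  congr 1
  refine Fintype.sum_equiv (Equiv.addLeft a) _ _ fun s => ?_
  rw [Equiv.coe_addLeft, t_pow_val_add, neg_add, t_pow_val_add]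
  exact (((t_mul_t_comm (i + 1) i hi _).pow_pow _ _)).mul_mul_mul_comm _ _

theorem e_mul_e (i : ℕ) (hi : i + 1 < n) :
    (e i hi * e i hi : YokonumaHecke d n u) = e i hi := by
  conv_lhs => enter [1]; rw [e_eq_sum_zmod]
  simp only [smul_mul_assoc, Finset.sum_mul, t_pow_mul_t_pow_neg_mul_e, Finset.sum_const,
    Finset.card_univ, card, ← Nat.cast_smul_eq_nsmul ℂ, smul_smul]
  rw [one_div_mul_cancel (NeZero.ne (d : ℂ)), one_smul]

theorem g_commute_e (i : ℕ) (hi : i + 1 < n) :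
    Commute (g i hi : YokonumaHecke d n u) (e i hi) := by
  have h : (e i hi : YokonumaHecke d n u) =
      (1 / (d : ℂ)) • ∑ a : ZMod d, t (i + 1) hi ^ a.val * t i (by omega) ^ (-a).val := by
    rw [e_eq_sum_zmod]
    congr 1
    refine Fintype.sum_equiv (Equiv.neg _) _ _ fun a => ?_
    rw [Equiv.neg_apply, neg_neg, ((t_mul_t_comm (i + 1) i hi _).pow_pow _ _).eq]
  have h' := (SemiconjBy.finset_sum_right Finset.univ fun (a : ZMod d) _ =>
    ((g_mul_t_left (d := d) (u := u) i hi).pow_right a.val).mul_right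
      ((g_mul_t_right i hi).pow_right (-a).val)).smul_right (1 / (d : ℂ))
  rwa [← e_eq_sum_zmod, ← h] at h'

/-- Each term `t_i^a t_{i+1}^{-a}` acts by `χ(am) χ(-am) = 1`, and `e_i` is the average of these
terms. -/
theorem e_mul_proj_mul_proj (i : ℕ) (hi : i + 1 < n) (m : ZMod d) :
    (e i hi * (proj i (by omega) m * proj (i + 1) hi m) : YokonumaHecke d n u) =
      proj i (by omega) m * proj (i + 1) hi m := by
  have h (a : ZMod d) : (t i (by omega) ^ a.val * t (i + 1) hi ^ (-a).val *
      (proj i (by omega) m * proj (i + 1) hi m) : YokonumaHecke d n u) =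
      proj i (by omega) m * proj (i + 1) hi m := by
    rw [((t_commute_proj (i + 1) i hi (by omega) m).pow_left _).mul_mul_mul_comm,
      t_pow_mul_proj, t_pow_mul_proj, smul_mul_smul_comm, ← AddChar.map_add_eq_mul, ← add_mul,
      add_neg_cancel, zero_mul, AddChar.map_zero_eq_one, one_smul]
  rw [e_eq_sum_zmod]
  simp only [smul_mul_assoc, Finset.sum_mul, h, Finset.sum_const,
    Finset.card_univ, card, ← Nat.cast_smul_eq_nsmul ℂ, smul_smul]
  rw [one_div_mul_cancel (NeZero.ne (d : ℂ)), one_smul]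

theorem g_isUnit (hu : u ≠ 0) (i : ℕ) (hi : i + 1 < n) :
    IsUnit (g i hi : YokonumaHecke d n u) := by
  set G : YokonumaHecke d n u := g i hi
  set e' : YokonumaHecke d n u := e i hi
  have hge : G * e' = e' * G := (g_commute_e i hi).eq
  have hGG : G * G = 1 + (u - 1) • e' + (u - 1) • (e' * G) := g_sq i hi
  have hee : e' * e' = e' := e_mul_e i hi
  have heGG : e' * G * G = u • e' + (u - 1) • (e' * G) := by
    rw [mul_assoc, hGG, mul_add, mul_add, mul_one, mul_smul_comm, mul_smul_comm, ← mul_assoc, hee]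
    module
  -- The inverse is read off the quadratic relation: off `e'` it is `G` itself, and on `e'` it is
  -- `u⁻¹ (G - (u - 1))`.
  have h₁ : (G + (u⁻¹ - 1) • (e' + e' * G)) * G = 1 := by
    rw [add_mul, smul_mul_assoc, add_mul, heGG, hGG]
    match_scalars <;> field_simp <;> ring
  have h₂ : G * (G + (u⁻¹ - 1) • (e' + e' * G)) = 1 := by
    rw [mul_add, mul_smul_comm, mul_add, ← mul_assoc, hge, heGG, hGG]
    match_scalars <;> field_simp <;> ring
  exact ⟨⟨G, _, h₂, h₁⟩, rfl⟩

/-! ### The elements `r_{i,i+1}` -/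

/-- The idempotent onto the common eigenspace of `t_i`, `t_{i+1}`, `t_{i+2}` for the
eigenvalue `χ(m)`. -/
noncomputable def tripleProj (i : ℕ) (hi : i + 2 < n) (m : ZMod d) : YokonumaHecke d n u :=
  proj i (by omega) m * proj (i + 1) (by omega) m * proj (i + 2) hi m

/-- Substituting `a = -(b + c)`, the first strand contributes the scalar `χ(-(b + c)m)`. The sum
then splits into independent sums over `b` and `c`, each equal to `d` times an idempotent; hence the
factor `d²`. -/
theorem proj_mul_r (i : ℕ) (hi : i + 2 < n) (m : ZMod d) :
    (proj i (by omega) m * r i hi : YokonumaHecke d n u) =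
      (d : ℂ) ^ 2 • (tripleProj i hi m * steinberg i hi) := by
  have hp (j : ℕ) (hj : j < n) : (d : ℂ) • (proj j hj m : YokonumaHecke d n u) =
      ∑ s : ZMod d, stdAddChar (-(s * m)) • t j hj ^ s.val := by
    rw [proj, smul_smul, mul_one_div_cancel (NeZero.ne (d : ℂ)), one_smul]
  have hr : ((d : ℂ) ^ 2 • (tripleProj i hi m * steinberg i hi) : YokonumaHecke d n u) =
      proj i (by omega) m * ((d : ℂ) • proj (i + 1) (by omega) m) *
        ((d : ℂ) • proj (i + 2) hi m) * steinberg i hi := by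
    rw [tripleProj, mul_smul_comm _ (proj i _ m), smul_mul_smul_comm, smul_mul_assoc, pow_two]
  rw [hr, hp, hp]
  simp only [r, Finset.mul_sum, Finset.sum_mul]
  rw [Finset.sum_comm, Finset.sum_comm (s := Finset.univ (α := ZMod d))
    (t := Finset.univ (α := ZMod d)) (f := fun c b => _ * _ * _ * steinberg i hi)]
  refine Finset.sum_congr rfl fun b _ => ?_
  rw [Finset.sum_comm]
  refine Finset.sum_congr rfl fun c _ => ?_
  rw [Finset.sum_eq_single (-(b + c))]
  · rw [if_pos (by ring)]
    simp only [← mul_assoc, proj_mul_t_pow, mul_smul_comm, smul_mul_assoc, smul_smul,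
      ← AddChar.map_add_eq_mul]
    congr 2
    ring
  · intro a _ ha
    rw [if_neg, mul_zero]
    intro h
    exact ha (by linear_combination h)
  · simp

theorem r_eq_sum (i : ℕ) (hi : i + 2 < n) :
    (r i hi : YokonumaHecke d n u) =
      (d : ℂ) ^ 2 • ∑ m, tripleProj i hi m * steinberg i hi := by
  rw [Finset.smul_sum]
  simp only [← proj_mul_r]
  rw [← Finset.sum_mul, sum_proj, one_mul]

theorem g_commute_tripleProj_left (i : ℕ) (hi : i + 2 < n) (m : ZMod d) :
    Commute (g i (by omega) : YokonumaHecke d n u) (tripleProj i hi m) := by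
  have h := ((semiconjBy_proj (g_mul_t_left (d := d) (u := u) i (by omega)) m).mul_right
    (semiconjBy_proj (g_mul_t_right i (by omega)) m)).mul_right
    (semiconjBy_proj (g_mul_t_other i (i + 2) (by omega) hi (by omega) (by omega)) m)
  rwa [(proj_commute_proj (i + 1) i _ _ m m).eq] at h

theorem g_commute_tripleProj_right (i : ℕ) (hi : i + 2 < n) (m : ZMod d) :
    Commute (g (i + 1) (by omega) : YokonumaHecke d n u) (tripleProj i hi m) := by
  have h := (semiconjBy_proj (g_mul_t_other (d := d) (u := u) (i + 1) i (by omega) (by omega)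
    (by omega) (by omega)) m).mul_right ((semiconjBy_proj (g_mul_t_left (i + 1) hi) m).mul_right
    (semiconjBy_proj (g_mul_t_right (i + 1) hi) m))
  rw [(proj_commute_proj (i + 1 + 1) (i + 1) _ _ m m).eq, ← mul_assoc] at h
  exact h

/-- Since `e_i` acts as the identity on the corner, the quadratic relation becomes the ordinary
Hecke relation. -/
theorem tripleProj_mul_g_mul_g_left (i : ℕ) (hi : i + 2 < n) (m : ZMod d) :
    (tripleProj i hi m * g i (by omega) * g i (by omega) : YokonumaHecke d n u) =
      u • tripleProj i hi m + (u - 1) • (tripleProj i hi m * g i (by omega)) := by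
  have he : (e i (by omega) * tripleProj i hi m : YokonumaHecke d n u) = tripleProj i hi m := by
    rw [tripleProj, ← mul_assoc, e_mul_proj_mul_proj]
  rw [(g_commute_tripleProj_left i hi m).symm.eq, mul_assoc,
    (g_commute_tripleProj_left i hi m).symm.eq, ← mul_assoc, g_sq, add_mul, add_mul,
    one_mul, smul_mul_assoc, smul_mul_assoc, ← (g_commute_e i _).eq, mul_assoc, he]
  module

theorem tripleProj_mul_g_mul_g_right (i : ℕ) (hi : i + 2 < n) (m : ZMod d) :
    (tripleProj i hi m * g (i + 1) (by omega) * g (i + 1) (by omega) : YokonumaHecke d n u) =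
      u • tripleProj i hi m + (u - 1) • (tripleProj i hi m * g (i + 1) (by omega)) := by
  have he : (e (i + 1) (by omega) * tripleProj i hi m : YokonumaHecke d n u) =
      tripleProj i hi m := by
    rw [tripleProj, mul_assoc, (proj_commute_proj i (i + 1) (by omega) (by omega) m m).left_comm,
      (proj_commute_proj i (i + 2) (by omega) (by omega) m m).eq, ← mul_assoc (proj (i + 1) _ m),
      ← mul_assoc (e _ _), e_mul_proj_mul_proj]
  rw [(g_commute_tripleProj_right i hi m).symm.eq, mul_assoc,
    (g_commute_tripleProj_right i hi m).symm.eq, ← mul_assoc, g_sq, add_mul, add_mul,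
    one_mul, smul_mul_assoc, smul_mul_assoc, ← (g_commute_e (i + 1) _).eq, mul_assoc, he]
  module

theorem g_mul_tripleProj_mul_steinberg (i j : ℕ) (hi : i + 2 < n) (hj : j = i ∨ j = i + 1)
    (m : ZMod d) :
    (g j (by omega) * (tripleProj i hi m * steinberg i hi) : YokonumaHecke d n u) =
      u • (tripleProj i hi m * steinberg i hi) := by
  obtain rfl | rfl := hj
  · exact mul_steinberg_left (g_commute_tripleProj_left j hi m).symm
      (tripleProj_mul_g_mul_g_left j hi m)
  · exact mul_steinberg_right (g_commute_tripleProj_right i hi m).symm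
      (tripleProj_mul_g_mul_g_right i hi m) (g_braid i _ _)

theorem t_mul_tripleProj (i j : ℕ) (hi : i + 2 < n) (hj : j = i ∨ j = i + 1 ∨ j = i + 2)
    (m : ZMod d) :
    (t j (by omega) * tripleProj i hi m : YokonumaHecke d n u) =
      stdAddChar m • tripleProj i hi m := by
  obtain rfl | rfl | rfl := hj
  · rw [tripleProj, ← mul_assoc, ← mul_assoc, t_mul_proj, smul_mul_assoc, smul_mul_assoc]
  · rw [tripleProj, ← mul_assoc, ← mul_assoc, (t_commute_proj (i + 1) i _ _ m).eq,
      mul_assoc (proj i _ m), t_mul_proj, mul_smul_comm, smul_mul_assoc]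
  · rw [tripleProj, ((t_commute_proj (i + 2) i hi _ m).mul_right
      (t_commute_proj (i + 2) (i + 1) hi _ m)).left_comm, t_mul_proj, mul_smul_comm]

theorem incl_r (i : ℕ) (hi : i + 2 < n) :
    incl (r i hi : YokonumaHecke d n u) = r i (by omega) := by
  simp only [r, map_sum, apply_ite incl, map_mul, map_pow, incl_t, incl_steinberg, map_zero]

/-- Conjugation by `g_i g_{i+1} g_{i+2}` shifts the strands `i`, `i+1`, `i+2` by one. -/
theorem semiconjBy_r (i : ℕ) (hi : i + 3 < n) :
    SemiconjBy (g i (by omega) * g (i + 1) (by omega) * g (i + 2) hi : YokonumaHecke d n u)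
      (r i (by omega)) (r (i + 1) hi) := by
  set w : YokonumaHecke d n u := g i (by omega) * g (i + 1) (by omega) * g (i + 2) hi
  have ht₀ : SemiconjBy w (t i (by omega)) (t (i + 1) (by omega)) :=
    ((g_mul_t_left i _).mul_left (g_mul_t_other (i + 1) i _ _ (by omega) (by omega))).mul_left
      (g_mul_t_other (i + 2) i _ _ (by omega) (by omega))
  have ht₁ : SemiconjBy w (t (i + 1) (by omega)) (t (i + 2) (by omega)) :=
    (SemiconjBy.mul_left (g_mul_t_other i (i + 2) _ _ (by omega) (by omega))
      (g_mul_t_left (i + 1) (by omega))).mul_left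
      (g_mul_t_other (i + 2) (i + 1) _ _ (by omega) (by omega))
  have ht₂ : SemiconjBy w (t (i + 2) (by omega)) (t (i + 3) hi) :=
    (SemiconjBy.mul_left (g_mul_t_other i (i + 3) _ _ (by omega) (by omega))
      (g_mul_t_other (i + 1) (i + 3) _ _ (by omega) (by omega))).mul_left
      (g_mul_t_left (i + 2) hi)
  have hg₀ : SemiconjBy w (g i (by omega)) (g (i + 1) (by omega)) := by
    have h : SemiconjBy (g i (by omega) * g (i + 1) (by omega) : YokonumaHecke d n u)
        (g i (by omega)) (g (i + 1) (by omega)) := by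
      rw [SemiconjBy, ← mul_assoc, g_braid]
    exact h.mul_left (g_mul_g_comm (i + 2) i _ _ (by omega))
  have hg₁ : SemiconjBy w (g (i + 1) (by omega)) (g (i + 2) hi) := by
    have h : SemiconjBy (g (i + 1) (by omega) * g (i + 2) hi : YokonumaHecke d n u)
        (g (i + 1) (by omega)) (g (i + 2) hi) := by
      rw [SemiconjBy, ← mul_assoc, g_braid]
    have h' := SemiconjBy.mul_left (g_mul_g_comm (d := d) (u := u) i (i + 2) (by omega) hi
      (by omega)) h
    rwa [← mul_assoc] at h'
  have hs : SemiconjBy w (steinberg i (by omega)) (steinberg (i + 1) hi) :=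
    (((((SemiconjBy.one_right w).add_right hg₀).add_right hg₁).add_right
      (hg₀.mul_right hg₁)).add_right (hg₁.mul_right hg₀)).add_right
      ((hg₀.mul_right hg₁).mul_right hg₀)
  refine SemiconjBy.finset_sum_right _ fun a _ => SemiconjBy.finset_sum_right _ fun b _ =>
    SemiconjBy.finset_sum_right _ fun c _ => ?_
  split_ifs
  · exact (((ht₀.pow_right _).mul_right (ht₁.pow_right _)).mul_right (ht₂.pow_right _)).mul_right hs
  · exact SemiconjBy.zero_right w

end YokonumaHecke

/-! ### The trace on three strands, and reduction of the general case to it -/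

namespace IsJuyumayaTrace

open YokonumaHecke ZMod

variable {d : ℕ} {u z : ℂ} {x : ZMod d → ℂ} {tr : ∀ k : ℕ, YokonumaHecke d k u →ₗ[ℂ] ℂ}

theorem tr_incl_mul_g_mul_incl (htr : IsJuyumayaTrace d u z x tr) (m : ℕ)
    (a b : YokonumaHecke d (m + 1) u) :
    tr (m + 2) (incl a * g m (by omega) * incl b) = z * tr (m + 1) (b * a) := by
  rw [htr.trace, ← mul_assoc, ← map_mul, htr.markov]

theorem tr_incl_mul_t_pow (htr : IsJuyumayaTrace d u z x tr) (hx : x 0 = 1) (m : ℕ)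
    (a : YokonumaHecke d (m + 1) u) (s : ZMod d) :
    tr (m + 2) (incl a * t (m + 1) (by omega) ^ s.val) = x s * tr (m + 1) a := by
  obtain rfl | hs := eq_or_ne s 0
  · rw [val_zero, pow_zero, mul_one, htr.compat, hx, one_mul]
  · exact htr.framing m a s hs

variable [NeZero d]

theorem tr_incl_mul_proj (htr : IsJuyumayaTrace d u z x tr) (hx : x 0 = 1) (k : ℕ)
    (a : YokonumaHecke d (k + 1) u) (m : ZMod d) :
    tr (k + 2) (incl a * proj (k + 1) (by omega) m) = dft x m / d * tr (k + 1) a := by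
  simp only [proj, mul_smul_comm, Finset.mul_sum, _root_.map_smul, map_sum, htr.tr_incl_mul_t_pow hx,
    dft_apply, smul_eq_mul, Finset.sum_div, Finset.sum_mul]
  exact Finset.sum_congr rfl fun s _ => by ring

/-- The framing rule only concerns a newly added strand. The first strand is reached on two strands,
by conjugating with the invertible `g_0`. -/
theorem tr_proj_zero (htr : IsJuyumayaTrace d u z x tr) (hu : u ≠ 0) (hx : x 0 = 1) (m : ZMod d) :
    tr 1 (proj 0 (by omega) m) = dft x m / d := by
  obtain ⟨G, hG⟩ := g_isUnit (d := d) (n := 2) hu 0 (by omega)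
  have h := semiconjBy_proj (g_mul_t_left (d := d) (n := 2) (u := u) 0 (by omega)) m
  rw [← hG] at h
  have h' := htr.tr_incl_mul_proj hx 0 1 m
  rw [map_one, one_mul, htr.unit, mul_one] at h'
  rw [← htr.compat, incl_proj, ← h', ← (Units.mul_inv_eq_iff_eq_mul G).mpr h.eq, htr.trace,
    Units.inv_mul_cancel_left]

/-- The value of the trace on `E_m (∑ g_w)` where `E_m` projects three strands onto `χ(m)`. -/
theorem tr_tripleProj_mul_steinberg (htr : IsJuyumayaTrace d u z x tr) (hu : u ≠ 0)
    (hx : x 0 = 1) (m : ZMod d) :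
    tr 3 (tripleProj 0 (by omega) m * steinberg 0 (by omega)) =
      dft x m / d * (dft x m / d + z) * (dft x m / d + (u + 1) * z) := by
  set X := dft x m / d
  -- Two strands.
  set p : YokonumaHecke d 2 u := proj 0 (by omega) m with hp
  set q : YokonumaHecke d 2 u := proj 1 (by omega) m with hq
  set G : YokonumaHecke d 2 u := g 0 (by omega) with hG
  have hpp : p * p = p := proj_mul_proj _ _ _
  have hqq : q * q = q := proj_mul_proj _ _ _
  have hpq : p * q = q * p := (proj_commute_proj _ _ _ _ _ _).eq
  have hGp : G * p = q * G := (semiconjBy_proj (g_mul_t_left 0 (by omega)) m).eq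
  have hGq : G * q = p * G := (semiconjBy_proj (g_mul_t_right 0 (by omega)) m).eq
  have h₁ : tr 1 (proj 0 (by omega) m) = X := htr.tr_proj_zero hu hx m
  have h₂ : tr 2 (p * q) = X ^ 2 := by
    have := htr.tr_incl_mul_proj hx 0 (proj 0 (by omega) m) m
    rw [incl_proj, h₁] at this
    rw [pow_two]
    exact this
  have h₂' : tr 2 (p * q * G) = z * X := by
    have := htr.markov 0 (proj 0 (by omega) m)
    rw [incl_proj, h₁] at this
    -- `p q G = p G p`, whose trace is that of `p G` by cyclicity.
    rw [mul_assoc, ← hGp, ← mul_assoc, htr.trace 1, ← mul_assoc, hpp]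
    exact this
  have h₂'' : tr 2 (p * q * G * G) = u * X ^ 2 + (u - 1) * (z * X) := by
    have hc : p * q * G = G * (p * q) := by
      rw [← mul_assoc, hGp, mul_assoc q, hGq, ← mul_assoc, hpq]
    have he : p * q * G * G = u • (p * q) + (u - 1) • (p * q * G) := by
      rw [hc, mul_assoc, hc, ← mul_assoc, hG, g_sq, add_mul, add_mul, one_mul, smul_mul_assoc,
        smul_mul_assoc, ← (g_commute_e 0 _).eq, mul_assoc, e_mul_proj_mul_proj]
      module
    rw [he, map_add, _root_.map_smul, _root_.map_smul, h₂, h₂', smul_eq_mul, smul_eq_mul]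
  -- Three strands.
  set P : YokonumaHecke d 3 u := incl (p * q) with hP
  set s : YokonumaHecke d 3 u := proj 2 (by omega) m
  set A : YokonumaHecke d 3 u := incl G with hA
  set B : YokonumaHecke d 3 u := g 1 (by omega)
  have hA' : A = g 0 (by omega) := incl_g 0 _
  have hE : (tripleProj 0 (by omega) m : YokonumaHecke d 3 u) = P * s := by
    rw [tripleProj, hP, map_mul, hp, hq, incl_proj, incl_proj]
  have hBq : B * incl q = s * B := by
    rw [hq, incl_proj]
    exact (semiconjBy_proj (g_mul_t_left 1 (by omega)) m).eq
  have hEA : P * s * A = A * (P * s) := by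
    rw [← hE, hA']; exact (g_commute_tripleProj_left 0 _ m).symm.eq
  have htrs (a : YokonumaHecke d 2 u) : tr 3 (incl a * s) = X * tr 2 a :=
    htr.tr_incl_mul_proj hx 1 a m
  -- Moving `s` through `B` turns it into `q`, leaving `B` between two-strand elements, where the
  -- Markov rule applies.
  have htrB (a : YokonumaHecke d 2 u) : tr 3 (P * s * (B * incl a)) = z * tr 2 (p * q * a) := by
    have : P * s * (B * incl a) = P * B * (incl (q * a)) := by
      rw [map_mul, ← mul_assoc, ← mul_assoc, mul_assoc P s, ← hBq, ← mul_assoc]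
    rw [this, hP]
    refine (htr.tr_incl_mul_g_mul_incl 1 (p * q) (q * a)).trans ?_
    rw [htr.trace 1, ← mul_assoc, mul_assoc p, hqq]
  have e₁ : tr 3 (P * s) = X ^ 3 := by rw [htrs, h₂]; ring
  have e₂ : tr 3 (P * s * A) = z * X ^ 2 := by
    rw [hEA, ← mul_assoc, hP, hA, ← map_mul, htrs, htr.trace 1, h₂']; ring
  have e₃ : tr 3 (P * s * B) = z * X ^ 2 := by
    have := htrB 1
    rwa [map_one, mul_one, mul_one, h₂] at this
  have e₄ : tr 3 (P * s * (B * A)) = z ^ 2 * X := by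
    rw [hA, htrB, h₂']; ring
  have e₅ : tr 3 (P * s * (A * B)) = z ^ 2 * X := by
    rw [← mul_assoc, hEA, mul_assoc, htr.trace 2, mul_assoc, e₄]
  have e₆ : tr 3 (P * s * (A * B * A)) = z * (u * X ^ 2 + (u - 1) * (z * X)) := by
    rw [mul_assoc A, ← mul_assoc, hEA, mul_assoc, htr.trace 2, mul_assoc (P * s), mul_assoc B, hA,
      ← map_mul,
      htrB, ← mul_assoc, h₂'']
  rw [hE, steinberg, ← hA']
  change tr 3 (P * s * (1 + A + B + A * B + B * A + A * B * A)) = _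
  rw [mul_add, mul_add, mul_add, mul_add, mul_add, mul_one, map_add, map_add, map_add, map_add,
    map_add, e₁, e₂, e₃, e₄, e₅, e₆]
  -- The terms add up to `X³ + 2zX² + 2z²X + z(uX² + (u - 1)zX)`, which factors as claimed.
  ring

/-- The trace kills the left ideal generated by `r_{1,2}` on `k` strands. -/
def KillsFirst (tr : ∀ k : ℕ, YokonumaHecke d k u →ₗ[ℂ] ℂ) (k : ℕ) : Prop :=
  ∀ (hk : 0 + 2 < k) (y : YokonumaHecke d k u), tr k (y * r 0 hk) = 0

theorem killsFirst_three_iff (htr : IsJuyumayaTrace d u z x tr) (hu : u ≠ 0) (hx : x 0 = 1) :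
    KillsFirst tr 3 ↔
      ∀ m, dft x m / d * (dft x m / d + z) * (dft x m / d + (u + 1) * z) = 0 := by
  constructor
  · intro h m
    -- Projecting the first strand isolates the summand of `r` with index `m`.
    have h' := h (by omega) (proj 0 (by omega) m)
    rw [proj_mul_r, _root_.map_smul, htr.tr_tripleProj_mul_steinberg hu hx, smul_eq_mul] at h'
    exact (mul_eq_zero.mp h').resolve_left (pow_ne_zero 2 (NeZero.ne (d : ℂ)))
  · intro h hk y
    -- Every generator acts on each spanning vector by a scalar, so `V` is a left ideal; it contains
    -- `r`.
    let V : Submodule ℂ (YokonumaHecke d 3 u) :=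
      Submodule.span ℂ (Set.range fun m => tripleProj 0 hk m * steinberg 0 hk)
    have hV : V ≤ LinearMap.ker (tr 3) := by
      rw [Submodule.span_le]
      rintro _ ⟨m, rfl⟩
      rw [SetLike.mem_coe, LinearMap.mem_ker, htr.tr_tripleProj_mul_steinberg hu hx, h]
    have hstable (w : YokonumaHecke d 3 u) (c : ZMod d → ℂ)
        (hw : ∀ m, w * (tripleProj 0 hk m * steinberg 0 hk) =
          c m • (tripleProj 0 hk m * steinberg 0 hk)) : ∀ v ∈ V, w * v ∈ V := by
      have : V ≤ V.comap (LinearMap.mulLeft ℂ w) := by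
        rw [Submodule.span_le]
        rintro _ ⟨m, rfl⟩
        rw [SetLike.mem_coe, Submodule.mem_comap, LinearMap.mulLeft_apply, hw]
        exact V.smul_mem _ (Submodule.subset_span ⟨m, rfl⟩)
      exact this
    refine hV (mul_mem_of_generators V (fun i hi => hstable _ (fun _ => u) fun m => ?_)
      (fun j hj => hstable _ (fun m => stdAddChar m) fun m => ?_) y ?_)
    · exact g_mul_tripleProj_mul_steinberg 0 i hk (by omega) m
    · rw [← mul_assoc, t_mul_tripleProj 0 j hk (by omega) m, smul_mul_assoc]
    · rw [r_eq_sum]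
      exact V.smul_mem _ (V.sum_mem fun m _ => Submodule.subset_span ⟨m, rfl⟩)

/-- With `k ≥ 2`, the element `r` already lives on one strand fewer. On the spanning elements `a
t^s` and `a g b`, the framing and Markov rules therefore reduce the trace to a multiple of a trace
of the form `tr (y r)` on fewer strands. -/
theorem killsFirst_succ_iff (htr : IsJuyumayaTrace d u z x tr) (hx : x 0 = 1) (k : ℕ)
    (hk : 0 + 2 < k + 1) : KillsFirst tr (k + 2) ↔ KillsFirst tr (k + 1) := by
  constructor
  · intro h _ y
    rw [← htr.compat, map_mul, incl_r]
    exact h _ _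
  · intro h hk' y
    have hy : y ∈ inductiveSpan d (k + 1) u := by
      rw [inductiveSpan_eq_top]; exact Submodule.mem_top
    refine inductiveSpan_le (V := LinearMap.ker (tr (k + 2) ∘ₗ LinearMap.mulRight ℂ (r 0 hk')))
      (fun a s => ?_) (fun a b i hi hik => ?_) hy
    · change tr (k + 2) (incl a * t (k + 1) _ ^ s * r 0 hk') = 0
      rw [← incl_r 0 hk, mul_assoc, ((t_last_commute_incl _).pow_left s).eq, ← mul_assoc, ← map_mul,
        ← t_pow_val_natCast, htr.tr_incl_mul_t_pow hx, h hk, mul_zero]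
    · obtain rfl : i = k := by omega
      change tr (i + 2) (incl a * g i _ * incl b * r 0 hk') = 0
      rw [← incl_r 0 hk, mul_assoc, ← map_mul, htr.tr_incl_mul_g_mul_incl, mul_assoc, htr.trace,
        mul_assoc, htr.trace, h hk, mul_zero]

theorem killsFirst_iff (htr : IsJuyumayaTrace d u z x tr) (hx : x 0 = 1) {n : ℕ} (hn : 3 ≤ n) :
    KillsFirst tr n ↔ KillsFirst tr 3 := by
  induction n, hn using Nat.le_induction with
  | base => rfl
  | succ k hk ih =>
    obtain ⟨k, rfl⟩ : ∃ l, k = l + 1 := ⟨k - 1, by omega⟩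
    rw [htr.killsFirst_succ_iff hx k (by omega), ih]

/-- Induction on `i`: `r_{i+1} = w r_i w⁻¹` for the unit `w = g_i g_{i+1} g_{i+2}`, and cyclicity
moves `w⁻¹` to the front. -/
theorem tr_mul_r_eq_zero (htr : IsJuyumayaTrace d u z x tr) (hu : u ≠ 0) {n : ℕ}
    (h : KillsFirst tr (n + 1)) (i : ℕ) (hi : i + 2 < n + 1) (y : YokonumaHecke d (n + 1) u) :
    tr (n + 1) (y * r i hi) = 0 := by
  induction i generalizing y with
  | zero => exact h hi y
  | succ i ih =>
    obtain ⟨w, hw⟩ := ((g_isUnit (d := d) (n := n + 1) hu i (by omega)).mul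
      (g_isUnit hu (i + 1) (by omega))).mul (g_isUnit hu (i + 2) hi)
    have hs := semiconjBy_r (d := d) (u := u) i hi
    rw [← hw] at hs
    rw [← (Units.mul_inv_eq_iff_eq_mul w).mpr hs.eq, ← mul_assoc, htr.trace, ← mul_assoc,
      ← mul_assoc]
    exact ih _ _

theorem passesToFTL_iff (htr : IsJuyumayaTrace d u z x tr) (hu : u ≠ 0) {n : ℕ} (hn : 3 ≤ n) :
    PassesToFTL (tr n) ↔ KillsFirst tr n := by
  obtain ⟨n, rfl⟩ : ∃ l, n = l + 1 := ⟨n - 1, by omega⟩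
  constructor
  · rintro ⟨σ, hσ⟩ hk y
    have hmem : y * r 0 hk ∈ ftlIdeal d (n + 1) u :=
      TwoSidedIdeal.mul_mem_left _ _ _ (TwoSidedIdeal.subset_span ⟨0, hk, rfl⟩)
    have h0 : (ftlIdeal d (n + 1) u).ringCon.mk' (y * r 0 hk) = 0 :=
      (RingCon.eq _).mpr hmem
    rw [← hσ, h0, map_zero]
  · intro h
    -- The radical of the form `(b, a) ↦ tr (b a)`; cyclicity of the trace makes it two-sided, so
    -- testing left multiples of the generators is enough.
    let J : TwoSidedIdeal (YokonumaHecke d (n + 1) u) :=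
      TwoSidedIdeal.mk' {a | ∀ b, tr (n + 1) (b * a) = 0}
        (fun b => by rw [mul_zero, map_zero])
        (fun {a a'} ha ha' b => by rw [mul_add, map_add, ha, ha', add_zero])
        (fun {a} ha b => (congrArg _ (mul_neg b a)).trans (by rw [map_neg, ha, neg_zero]))
        (fun {c a} ha b => by rw [← mul_assoc, ha])
        (fun {a c} ha b => by rw [← mul_assoc, htr.trace, ← mul_assoc, ha])
    have hJ : ftlIdeal d (n + 1) u ≤ J := by
      rw [ftlIdeal, TwoSidedIdeal.span_le]
      rintro _ ⟨i, hi, rfl⟩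
      exact (TwoSidedIdeal.mem_mk' ..).mpr fun b => htr.tr_mul_r_eq_zero hu h i hi b
    have hker {a b : YokonumaHecke d (n + 1) u} (hab : (ftlIdeal d (n + 1) u).ringCon a b) :
        tr (n + 1) a = tr (n + 1) b := by
      have := (TwoSidedIdeal.mem_mk' ..).mp (hJ (((ftlIdeal d (n + 1) u).rel_iff a b).mp hab)) 1
      rwa [one_mul, map_sub, sub_eq_zero] at this
    refine ⟨{ toFun := fun q => Quotient.liftOn' q (tr (n + 1)) fun a b hab => hker hab
              map_add' := ?_
              map_smul' := ?_ }, fun a => rfl⟩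
    · rintro ⟨a⟩ ⟨b⟩
      exact map_add (tr (n + 1)) a b
    · rintro c ⟨a⟩
      exact map_smul (tr (n + 1)) c a

end IsJuyumayaTrace

/-! ### Fourier inversion on `ℤ/d` and the form of the parameters -/

section Fourier

open ZMod

variable {d : ℕ} [NeZero d]

theorem ZMod.dft_eq_iff_forall_eq_sum {x c : ZMod d → ℂ} :
    (∀ m, dft x m / d = c m) ↔ ∀ k, x k = ∑ m, c m * stdAddChar (k * m) := by
  have hd : (d : ℂ) ≠ 0 := NeZero.ne _
  have h₁ : (∀ m, dft x m / d = c m) ↔ dft x = (d : ℂ) • c := by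
    rw [funext_iff]
    exact forall_congr' fun m => by rw [div_eq_iff hd, Pi.smul_apply, smul_eq_mul, mul_comm]
  rw [h₁, ← LinearEquiv.eq_symm_apply, funext_iff]
  refine forall_congr' fun k => ?_
  rw [invDFT_apply, Finset.smul_sum]
  refine Eq.congr_right (Finset.sum_congr rfl fun m _ => ?_)
  simp only [Pi.smul_apply, smul_eq_mul]
  rw [mul_comm m k]
  field_simp

/-- The indicator combination with value `-z` on `S₁` and `-(u + 1) z` on `S₂`. -/
theorem sum_indicators_mul_stdAddChar (S₁ S₂ : Finset (ZMod d)) (u z : ℂ) (k : ZMod d) :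
    ∑ m, -z * ((if m ∈ S₁ then 1 else 0) + (u + 1) * (if m ∈ S₂ then 1 else 0)) *
      stdAddChar (k * m) =
    -z * (∑ m ∈ S₁, stdAddChar (k * m) + (u + 1) * ∑ m ∈ S₂, stdAddChar (k * m)) := by
  simp only [mul_assoc, ← Finset.mul_sum, add_mul, Finset.sum_add_distrib, ite_mul, one_mul,
    zero_mul, Finset.sum_ite_mem, Finset.univ_inter]

/-- The Fourier coefficients of `x` all lie in `{0, -z, -(u + 1) z}` exactly when `x` has the
stated form. -/
theorem fourier_roots_iff_exists_supports {u z : ℂ} {x : ZMod d → ℂ} (hx : x 0 = 1) :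
    (∀ m, dft x m / d * (dft x m / d + z) * (dft x m / d + (u + 1) * z) = 0) ↔
      ∃ Sup₁ Sup₂ : Finset (ZMod d),
        Disjoint Sup₁ Sup₂ ∧
        ((Sup₁ ∪ Sup₂ : Finset (ZMod d)) : Set (ZMod d)) = Function.support (ZMod.dft x) ∧
        (∀ k : ZMod d, x k = -z * (∑ m ∈ Sup₁, ZMod.stdAddChar (k * m) +
          (u + 1) * ∑ m ∈ Sup₂, ZMod.stdAddChar (k * m))) ∧
        (Sup₁.card : ℂ) + (u + 1) * (Sup₂.card : ℂ) ≠ 0 ∧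
        z = -1 / ((Sup₁.card : ℂ) + (u + 1) * (Sup₂.card : ℂ)) := by
  classical
  have hd : (d : ℂ) ≠ 0 := NeZero.ne _
  constructor
  · intro h
    -- The support is split by whether the coefficient is `-z`; defining `S₂` by the negation, not
    -- by the value `-(u + 1)z`, gives disjointness even if the two values coincide.
    set S₁ := Finset.univ.filter fun m => dft x m ≠ 0 ∧ dft x m / d = -z with hS₁
    set S₂ := Finset.univ.filter fun m => dft x m ≠ 0 ∧ dft x m / d ≠ -z with hS₂
    have hform : ∀ k : ZMod d, x k = -z * (∑ m ∈ S₁, stdAddChar (k * m) +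
        (u + 1) * ∑ m ∈ S₂, stdAddChar (k * m)) := by
      simp_rw [← sum_indicators_mul_stdAddChar]
      refine dft_eq_iff_forall_eq_sum.mp fun m => ?_
      by_cases h0 : dft x m = 0
      · simp [hS₁, hS₂, h0]
      by_cases h1 : dft x m / d = -z
      · simp [hS₁, hS₂, h0, h1]
      · have h2 : dft x m / d + (u + 1) * z = 0 :=
          (mul_eq_zero.mp (h m)).resolve_left
            (mul_ne_zero (div_ne_zero h0 hd) fun h' => h1 (eq_neg_of_add_eq_zero_left h'))
        simp only [hS₁, hS₂, Finset.mem_filter, Finset.mem_univ, h0, h1, not_false_eq_true,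
          ne_eq, and_true, and_false, if_true, if_false]
        linear_combination h2
    -- At `k = 0` all characters equal `1`, so `x 0 = 1` yields both the nonvanishing and the value
    -- of `z`.
    have hone : -z * ((S₁.card : ℂ) + (u + 1) * (S₂.card : ℂ)) = 1 := by
      have := hform 0
      simp only [zero_mul, AddChar.map_zero_eq_one, Finset.sum_const, nsmul_eq_mul, mul_one,
        hx] at this
      exact this.symm
    have hne : (S₁.card : ℂ) + (u + 1) * (S₂.card : ℂ) ≠ 0 := right_ne_zero_of_mul_eq_one hone
    refine ⟨S₁, S₂, ?_, ?_, hform, hne, ?_⟩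
    · rw [Finset.disjoint_left]
      intro m h₁ h₂
      exact (Finset.mem_filter.mp h₂).2.2 (Finset.mem_filter.mp h₁).2.2
    · ext m
      simp only [hS₁, hS₂, Finset.coe_union, Set.mem_union, Finset.mem_coe, Finset.mem_filter,
        Finset.mem_univ, true_and, Function.mem_support]
      tauto
    · rw [eq_div_iff hne]
      linear_combination -hone
  · rintro ⟨S₁, S₂, hdisj, -, hform, -, -⟩ m
    simp_rw [← sum_indicators_mul_stdAddChar] at hform
    rw [dft_eq_iff_forall_eq_sum.mpr hform m]
    by_cases h₁ : m ∈ S₁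
    · have h₂ : m ∉ S₂ := Finset.disjoint_left.mp hdisj h₁
      simp [h₁, h₂]
    · by_cases h₂ : m ∈ S₂ <;> simp [h₁, h₂]
      right; ring

end Fourier

theorem theorem6 (d n : ℕ) [NeZero d] (hn : 3 ≤ n) (u : ℂ) (hu : u ≠ 0)
    (z : ℂ) (x : ZMod d → ℂ) (hx : x 0 = 1)
    (tr : ∀ k : ℕ, YokonumaHecke d k u →ₗ[ℂ] ℂ) (htr : IsJuyumayaTrace d u z x tr) :
    PassesToFTL (tr n) ↔
      ∃ Sup₁ Sup₂ : Finset (ZMod d),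
        Disjoint Sup₁ Sup₂ ∧
        ((Sup₁ ∪ Sup₂ : Finset (ZMod d)) : Set (ZMod d)) = Function.support (ZMod.dft x) ∧
        (∀ k : ZMod d, x k = -z * (∑ m ∈ Sup₁, ZMod.stdAddChar (k * m) +
          (u + 1) * ∑ m ∈ Sup₂, ZMod.stdAddChar (k * m))) ∧
        (Sup₁.card : ℂ) + (u + 1) * (Sup₂.card : ℂ) ≠ 0 ∧
        z = -1 / ((Sup₁.card : ℂ) + (u + 1) * (Sup₂.card : ℂ)) := by
  rw [htr.passesToFTL_iff hu hn, htr.killsFirst_iff hx hn, htr.killsFirst_three_iff hu hx,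
    fourier_roots_iff_exists_supports hx]
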